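/- Let $\mathcal C$ be a variety of universal algebras, i.e. the category of all algebras over a finitary signature that satisfy a given set of identities, with homomorphisms as morphisms (the empty algebra is allowed if there are no constant symbols). A category with finite products is called coextensive if for all objects $X,Y$ the canonical functor $X/\mathcal C\times Y/\mathcal C\to (X\times Y)/\mathcal C$, $(f,g)\mapsto f\times g$, is an equivalence. A diagonalising term of $\mathcal C$ is a $(k+2)$-ary term $t$, for some $k\ge 1$, together with constants (closed terms) $e_1,\dots,e_k,e_1',\dots,e_k'$ such that the identities $t(x,y,e_1,\dots,e_k)=x$ and $t(x,y,e_1',\dots,e_k')=y$ hold in $\mathcal C$. Given such a $t$, and two terms $\alpha,\beta$ in variables from a set $X$ and in further variables $c_1,\dots,c_k$, write $\alpha\simeq_t\beta$ if there are $n\ge 1$, $m,m'\ge 0$, variables $x_1,\dots,x_m\in X$, $(m+m')$-ary terms $u_1,\dots,u_n$ and $k$-ary terms $v_1,\dots,v_{m'},w_1,\dots,w_{m'}$ such that, with $\vec x=(x_1,\dots,x_m)$, $\vec c=(c_1,\dots,c_k)$, $\vec e=(e_1,\dots,e_k)$, $\vec e\,'=(e_1',\dots,e_k')$, the identities $$u_1(\vec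 x,w_1(\vec c),\dots,w_{m'}(\vec c))=\alpha,$$ $$u_i(\vec x,v_1(\vec c),\dots,v_{m'}(\vec c))=u_{i+1}(\vec x,w_1(\vec c),\dots,w_{m'}(\vec c))\qquad(1\le i<n),$$ $$u_n(\vec x,v_1(\vec c),\dots,v_{m'}(\vec c))=\beta$$ hold in $\mathcal C$ and, for each $1\le j\le m'$, at least one of the identities $$v_j(\vec c)=t(w_j(\vec e),w_j(\vec e\,'),\vec c),\qquad w_j(\vec c)=t(v_j(\vec e),v_j(\vec e\,'),\vec c)$$ holds in $\mathcal C$. Theorem. The variety $\mathcal C$ is coextensive if and only if 1. $\mathcal C$ has a diagonalising term $t$ (with some constants $e_i,e_i'$) for which the following hold: 2. $t(x,x,\vec c)\simeq_t x$, where $x,c_1,\dots,c_k$ are variables; 3. $s(t(x_1,y_1,\vec c),\dots,t(x_p,y_p,\vec c))\simeq_t t(s(x_1,\dots,x_p),s(y_1,\dots,y_p),\vec c)$ for every $p\ge 0$ and every $p$-ary basic operation $s$, where $x_1,\dots,x_p,y_1,\dots,y_p,c_1,\dots,c_k$ are variables. Moreover, for any given diagonalising term $t$ of $\mathcal C$ with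 constants $e_i,e_i'$, the variety $\mathcal C$ is coextensive if and only if conditions 2 and 3 hold for this $t$. -/

import Mathlib

open CategoryTheory CategoryTheory.Limits
open scoped FirstOrder

universe u v w

noncomputable section

/-! ### Coextensive categories -/

/-- The canonical functor `× : X/C × Y/C ⥤ (X × Y)/C` between coslice categories, sending a pair
of morphisms `(f, g)` to their product `f × g`. -/
def underProdFunctor {C : Type u} [Category.{v} C] [HasFiniteProducts C] (X Y : C) :
    Under X × Under Y ⥤ Under (X ⨯ Y) where
  obj P := Under.mk (prod.map P.1.hom P.2.hom)
  map {P Q} φ := Under.homMk (prod.map φ.1.right φ.2.right) (by simp)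

/-- A category is coextensive if it has finite products and, for all objects `X` and `Y`, the
canonical functor `× : X/C × Y/C ⥤ (X × Y)/C` is an equivalence of categories. -/
class IsCoextensive (C : Type u) [Category.{v} C] : Prop extends HasFiniteProducts C where
  isEquivalence : ∀ X Y : C, (underProdFunctor X Y).IsEquivalence

/-! ### Varieties of universal algebras

A signature is a first-order language without relation symbols; an algebra is a structure for it
(the empty carrier is allowed when there are no constant symbols). -/

/-- The identity `s = t` holds in the algebra `A`. -/
def SatisfiesIdentity {L : FirstOrder.Language.{u, v}} (A : Type u) [L.Structure A] {α : Type w}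
    (s t : L.Term α) : Prop :=
  ∀ a : α → A, s.realize a = t.realize a

/-- A variety of universal algebras over the (finitary) signature `L`, given by an arbitrary set of
identities in countably many variables. -/
structure Variety (L : FirstOrder.Language.{u, v}) [L.IsAlgebraic] where
  /-- The defining identities. -/
  identities : Set (L.Term ℕ × L.Term ℕ)

namespace Variety

/-- The algebras of the variety. -/
structure Alg {L : FirstOrder.Language.{u, v}} [L.IsAlgebraic] (V : Variety L) where
  /-- The underlying set. -/
  carrier : Type u
  /-- The operations. -/
  [str : L.Structure carrier]
  satisfies : ∀ p ∈ V.identities, SatisfiesIdentity carrier p.1 p.2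

attribute [instance] Alg.str

/-- A variety is regarded as a category with the homomorphisms of algebras as morphisms. -/
instance {L : FirstOrder.Language.{u, v}} [L.IsAlgebraic] (V : Variety L) : Category V.Alg where
  Hom A B := A.carrier →[L] B.carrier
  id A := FirstOrder.Language.Hom.id L A.carrier
  comp f g := g.comp f

/-- The identity `s = t` holds in the variety, that is, in all of its algebras. -/
def Holds {L : FirstOrder.Language.{u, v}} [L.IsAlgebraic] (V : Variety L) {α : Type w}
    (s t : L.Term α) : Prop :=
  ∀ A : V.Alg, SatisfiesIdentity A.carrier s t

end Variety

/-- A closed term (a constant), regarded as a term in any set of variables. -/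
def closedTerm {L : FirstOrder.Language.{u, v}} {α : Type w} (e : L.Term Empty) : L.Term α :=
  e.relabel Empty.elim

/-- The term `t(a, b, d₁, …, dₖ)`, for a `(2 + k)`-ary term `t`. -/
def diagApply {L : FirstOrder.Language.{u, v}} {k : ℕ} {α : Type w} (t : L.Term (Fin 2 ⊕ Fin k))
    (a b : L.Term α) (d : Fin k → L.Term α) : L.Term α :=
  t.subst (Sum.elim ![a, b] d)

namespace Variety

/-- A diagonalising term of a variety: a `(k + 2)`-ary term `t` with `k ≥ 1`, and constants
`e₁, …, eₖ, e₁', …, eₖ'` (closed terms, representing elements of the free algebra on the empty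
set), such that the identities `t(x, y, e₁, …, eₖ) = x` and `t(x, y, e₁', …, eₖ') = y` hold. -/
structure DiagonalisingTerm {L : FirstOrder.Language.{u, v}} [L.IsAlgebraic]
    (V : Variety L) where
  k : ℕ
  one_le_k : 1 ≤ k
  t : L.Term (Fin 2 ⊕ Fin k)
  e : Fin k → L.Term Empty
  e' : Fin k → L.Term Empty
  holds_fst : V.Holds (α := Fin 2)
    (diagApply t (.var 0) (.var 1) (fun i => closedTerm (e i))) (.var 0)
  holds_snd : V.Holds (α := Fin 2)
    (diagApply t (.var 0) (.var 1) (fun i => closedTerm (e' i))) (.var 1)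

namespace DiagonalisingTerm

/-- For a `k`-ary term `v`, the `k`-ary term
`t(v(e₁, …, eₖ), v(e₁', …, eₖ'), c₁, …, cₖ)` in the variables `c₁, …, cₖ`. -/
def diagSplit {L : FirstOrder.Language.{u, v}} [L.IsAlgebraic] {V : Variety L}
    (D : V.DiagonalisingTerm)
    (v : L.Term (Fin D.k)) : L.Term (Fin D.k) :=
  diagApply D.t (v.subst fun i => closedTerm (D.e i)) (v.subst fun i => closedTerm (D.e' i))
    .var

/-- For an `(m + m')`-ary term `u`, the term
`u(x₁, …, xₘ, v₁(c₁, …, cₖ), …, vₘ'(c₁, …, cₖ))`; here `x₁, …, xₘ` are variables from `X`, and the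
variables `c₁, …, cₖ` are those of the form `Sum.inr i`. -/
def plug {L : FirstOrder.Language.{u, v}} {X : Type w} {k m m' : ℕ} (u : L.Term (Fin m ⊕ Fin m'))
    (x : Fin m → X) (v : Fin m' → L.Term (Fin k)) : L.Term (X ⊕ Fin k) :=
  u.subst (Sum.elim (fun i => .var (Sum.inl (x i))) (fun j => (v j).relabel Sum.inr))

/-- The relation `α ≃ₜ β` between terms in the variables `X` and `c₁, …, cₖ`. The nonempty
sequence of terms `u₁, …, uₙ₊₁` is indexed by `Fin (n + 1)`. -/
def Sim {L : FirstOrder.Language.{u, v}} [L.IsAlgebraic] {V : Variety L}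
    (D : V.DiagonalisingTerm)
    {X : Type w} (α β : L.Term (X ⊕ Fin D.k)) : Prop :=
  ∃ (n m m' : ℕ) (x : Fin m → X) (u : Fin (n + 1) → L.Term (Fin m ⊕ Fin m'))
    (v w : Fin m' → L.Term (Fin D.k)),
    V.Holds (plug (u 0) x w) α ∧
    (∀ i : Fin n, V.Holds (plug (u i.castSucc) x v) (plug (u i.succ) x w)) ∧
    V.Holds (plug (u (Fin.last n)) x v) β ∧
    ∀ j : Fin m', V.Holds (v j) (D.diagSplit (w j)) ∨ V.Holds (w j) (D.diagSplit (v j))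

/-- The condition `t(x, x, c₁, …, cₖ) ≃ₜ x`. -/
def Idem {L : FirstOrder.Language.{u, v}} [L.IsAlgebraic] {V : Variety L}
    (D : V.DiagonalisingTerm) :
    Prop :=
  D.Sim (X := Fin 1)
    (diagApply D.t (.var (Sum.inl 0)) (.var (Sum.inl 0))
      (fun i => .var (Sum.inr i)))
    (.var (Sum.inl 0))

/-- The condition
`s(t(x₁, y₁, c₁, …, cₖ), …, t(xₚ, yₚ, c₁, …, cₖ)) ≃ₜ t(s(x₁, …, xₚ), s(y₁, …, yₚ), c₁, …, cₖ)`
for a basic operation `s` of arity `p`. The variables `xᵢ` and `yᵢ` are the elements of the two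
summands of `Fin p ⊕ Fin p`. -/
def Commutes {L : FirstOrder.Language.{u, v}} [L.IsAlgebraic] {V : Variety L}
    (D : V.DiagonalisingTerm)
    {p : ℕ} (s : L.Functions p) : Prop :=
  D.Sim (X := Fin p ⊕ Fin p)
    (.func s fun i =>
      diagApply D.t (.var (Sum.inl (Sum.inl i))) (.var (Sum.inl (Sum.inr i)))
        (fun i => .var (Sum.inr i)))
    (diagApply D.t
      (.func s fun i => .var (Sum.inl (Sum.inl i)))
      (.func s fun i => .var (Sum.inl (Sum.inr i)))
      (fun i => .var (Sum.inr i)))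

end DiagonalisingTerm

end Variety

end

/-! Throughout, `t(-,-,(e,e'))` acts on a product `A × B` by `(p, q) ↦ (p₁, q₂)`, and `≃ₜ` is the
congruence on terms in `X` and `c` that is generated by `v(c) ∼ t(v(e), v(e'), c)`.

Necessity. A diagonalising term comes from the subalgebra of `F × F`, with `F` free on `x, y`,
generated by `(x,x)`, `(y,y)` and all pairs of constants. It lies under `0 × 0`, so it splits as a
product compatibly with its inclusion, hence contains `(x,y)`, and a term expressing `(x,y)` is
diagonalising (`exists_diagonalisingTerm`). For any diagonalising `t`, the free algebra on `X` and
`c` modulo `≃ₜ` lies under `0 × 0` via `(a,b) ↦ t(a,b,c)`, so it is a product in which `c = (e,e')`.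
Terms that agree at `c = e` and at `c = e'` are therefore related (`Sim.of_isCoextensive`). Both
sides of conditions 2 and 3 do agree there.

Sufficiency. Given `X × Y → Z`, let `c` be the image of `(e,e')`. Conditions 2 and 3 become
equations in `Z`, saying that `z·w = t(z,w,c)` is idempotent and a homomorphism. It is then a
rectangular band, which decomposes `Z` as a product (`essSurj_underProdFunctor`). Full faithfulness
needs only `t`, since morphisms under `X × Y` preserve `(e,e')`. -/

noncomputable section

open FirstOrder.Language FirstOrder.Language.Structure

/-! ### Algebras and terms over a signature without relations. -/

namespace FirstOrder.Language

variable {L : Language.{u, v}}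

/-- A map between structures for an algebraic language that commutes with the operations. -/
def Hom.ofFun [L.IsAlgebraic] {M N : Type*} [L.Structure M] [L.Structure N] (f : M → N)
    (hf : ∀ {n : ℕ} (s : L.Functions n) (x : Fin n → M), f (funMap s x) = funMap s (f ∘ x)) :
    M →[L] N where
  toFun := f
  map_fun' := hf
  map_rel' r := isEmptyElim r

/-- The product of two algebras. -/
instance prodStructure [L.IsAlgebraic] {M N : Type*} [L.Structure M] [L.Structure N] :
    L.Structure (M × N) where
  funMap s x := (funMap s fun i => (x i).1, funMap s fun i => (x i).2)
  RelMap r _ := isEmptyElim r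

/-- The one-element algebra. -/
@[reducible]
def punitStructure [L.IsAlgebraic] : L.Structure PUnit where
  funMap _ _ := ⟨⟩
  RelMap r _ := isEmptyElim r

/-- The algebra of terms. -/
@[reducible]
def termStructure (L : Language.{u, v}) [L.IsAlgebraic] (α : Type*) : L.Structure (L.Term α) where
  funMap := Term.func
  RelMap r _ := isEmptyElim r

theorem Term.realize_termStructure [L.IsAlgebraic] {α β : Type*} (t : L.Term α) (σ : α → L.Term β) :
    @Term.realize L _ (termStructure L β) _ σ t = t.subst σ := by
  induction t with
  | var => rfl
  | func f ts ih => exact congrArg (Term.func f) (funext ih)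

theorem Term.exists_relabel_of_finite {ι α : Type*} [Finite ι] (u : ι → L.Term α) :
    ∃ (s : Finset α) (u' : ι → L.Term s), ∀ i, (u' i).relabel Subtype.val = u i := by
  classical
  have aux : ∀ {β : Type _} (t : L.Term α) (f : t.varFinset → β) (g : β → α),
      (∀ a, g (f a) = a) → (t.restrictVar f).relabel g = t := by
    intro β t f g h
    induction t with
    | var a => exact congrArg Term.var (h _)
    | func F ts ih => exact congrArg (Term.func F) (funext fun i => ih i _ fun a => h _)
  have := Fintype.ofFinite ι
  let s : Finset α := Finset.univ.biUnion fun i => (u i).varFinset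
  have hs : ∀ i, (u i).varFinset ⊆ s := fun i =>
    Finset.subset_biUnion_of_mem (fun i => (u i).varFinset) (Finset.mem_univ i)
  exact ⟨s, fun i => (u i).restrictVar fun a => ⟨a, hs i a.2⟩, fun i => aux _ _ _ fun a => rfl⟩

/-- Terms are built below over arbitrary, possibly infinite, index sets. A finite family of them
uses finitely many variables, which gives the common arities `m`, `m'` wherever `Fin`-indexed
variables are required. -/
theorem Term.exists_relabel_sum_of_finite {ι α β : Type*} [Finite ι] (u : ι → L.Term (α ⊕ β)) :
    ∃ (m n : ℕ) (x : Fin m → α) (y : Fin n → β) (u' : ι → L.Term (Fin m ⊕ Fin n)),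
      ∀ i, (u' i).relabel (Sum.map x y) = u i := by
  classical
  obtain ⟨s, u', hu⟩ := Term.exists_relabel_of_finite u
  let p : s → s.toLeft ⊕ s.toRight := fun a => match a with
    | ⟨.inl a, h⟩ => .inl ⟨a, Finset.mem_toLeft.2 h⟩
    | ⟨.inr a, h⟩ => .inr ⟨a, Finset.mem_toRight.2 h⟩
  refine ⟨_, _, fun i => (s.toLeft.equivFin.symm i).1, fun i => (s.toRight.equivFin.symm i).1,
    fun i => ((u' i).relabel p).relabel (Sum.map s.toLeft.equivFin s.toRight.equivFin),
    fun i => ?_⟩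
  rw [Term.relabel_relabel, Term.relabel_relabel, ← hu i]
  congr 1
  funext ⟨a, h⟩
  cases a <;> simp [p]

end FirstOrder.Language

namespace Variety

variable {L : FirstOrder.Language.{u, v}} [L.IsAlgebraic] {V : Variety L}

/-! ### The category of algebras: products, quotients and subalgebras. -/

namespace Alg

/-- The homomorphism underlying a morphism of algebras. -/
def toHom {A B : V.Alg} (f : A ⟶ B) : A.carrier →[L] B.carrier := f

/-- A homomorphism as a morphism of algebras. -/
def ofHom {A B : V.Alg} (f : A.carrier →[L] B.carrier) : A ⟶ B := f

theorem hom_ext {A B : V.Alg} {f g : A ⟶ B} (h : ∀ a, toHom f a = toHom g a) : f = g :=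
  FirstOrder.Language.Hom.ext h

theorem toHom_realize {A B : V.Alg} (f : A ⟶ B) {α : Type*} (t : L.Term α) (a : α → A.carrier) :
    toHom f (t.realize a) = t.realize (fun i => toHom f (a i)) :=
  (HomClass.realize_term (toHom f)).symm

theorem isIso_of_bijective {A B : V.Alg} (f : A ⟶ B) (hf : Function.Bijective (toHom f)) :
    IsIso f := by
  let e := Equiv.ofBijective _ hf
  have he : ∀ a, toHom f (e.symm a) = a := e.apply_symm_apply
  refine ⟨ofHom (.ofFun e.symm fun s x => hf.1 ?_), hom_ext fun a => e.symm_apply_apply a,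
    hom_ext fun a => he a⟩
  rw [he, HomClass.map_fun]
  congr 1
  funext i
  exact (he _).symm

/-- The product of two algebras, constructed on the cartesian product of the carriers. -/
@[simps carrier]
def prodAlg (A B : V.Alg) : V.Alg where
  carrier := A.carrier × B.carrier
  satisfies p hp a := by
    have h1 : ∀ t : L.Term ℕ, (t.realize a).1 = t.realize fun i => (a i).1 := fun t =>
      (HomClass.realize_term (L := L) (Hom.ofFun (N := A.carrier) Prod.fst fun _ _ => rfl)).symm
    have h2 : ∀ t : L.Term ℕ, (t.realize a).2 = t.realize fun i => (a i).2 := fun t =>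
      (HomClass.realize_term (L := L) (Hom.ofFun (N := B.carrier) Prod.snd fun _ _ => rfl)).symm
    exact Prod.ext (by rw [h1, h1, A.satisfies p hp]) (by rw [h2, h2, B.satisfies p hp])

/-- The one-element algebra. -/
def punitAlg (V : Variety L) : V.Alg where
  carrier := PUnit
  str := punitStructure
  satisfies _ _ _ := rfl

/-- The limit cone on the cartesian product. -/
def prodFan (A B : V.Alg) : BinaryFan A B :=
  BinaryFan.mk (P := prodAlg A B) (ofHom (.ofFun Prod.fst fun _ _ => rfl))
    (ofHom (.ofFun Prod.snd fun _ _ => rfl))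

/-- The cartesian product is a categorical product. -/
def prodFanIsLimit (A B : V.Alg) : IsLimit (prodFan A B) :=
  BinaryFan.isLimitMk
    (fun s => ofHom (.ofFun (fun a => (toHom s.fst a, toHom s.snd a)) fun f x =>
      Prod.ext (HomClass.map_fun (toHom s.fst) f x) (HomClass.map_fun (toHom s.snd) f x)))
    (fun _ => rfl) (fun _ => rfl)
    (fun s _ h1 h2 => hom_ext fun a => Prod.ext
      (congrArg (fun f : s.pt ⟶ A => toHom f a) h1) (congrArg (fun f : s.pt ⟶ B => toHom f a) h2))

instance : HasFiniteProducts V.Alg := by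
  have : HasTerminal V.Alg := by
    refine IsTerminal.hasTerminal (X := punitAlg V) (.ofUniqueHom (fun A => ?_) fun A m => ?_)
    · exact ofHom (B := punitAlg V) (.ofFun (N := (punitAlg V).carrier) (fun _ => PUnit.unit)
        fun _ _ => rfl)
    · exact hom_ext fun a => rfl
  have : HasBinaryProducts V.Alg :=
    have : ∀ A B : V.Alg, HasLimit (pair A B) := fun A B => ⟨⟨_, prodFanIsLimit A B⟩⟩
    hasBinaryProducts_of_hasLimit_pair _
  exact hasFiniteProducts_of_has_binary_and_terminal

section Prod

variable {A B : V.Alg}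

/-- The first component of an element of a product. -/
def fst (p : (A ⨯ B).carrier) : A.carrier := toHom prod.fst p

/-- The second component of an element of a product. -/
def snd (p : (A ⨯ B).carrier) : B.carrier := toHom prod.snd p

/-- The element of a product with given components. -/
def mkPair (a : A.carrier) (b : B.carrier) : (A ⨯ B).carrier :=
  toHom ((prodFanIsLimit A B).conePointUniqueUpToIso (prodIsProd A B)).hom (a, b)

@[simp]
theorem fst_mkPair (a : A.carrier) (b : B.carrier) : fst (mkPair a b) = a :=
  congrArg (fun f : prodAlg A B ⟶ A => toHom f (a, b))
    ((prodFanIsLimit A B).conePointUniqueUpToIso_hom_comp (prodIsProd A B) ⟨.left⟩)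

@[simp]
theorem snd_mkPair (a : A.carrier) (b : B.carrier) : snd (mkPair a b) = b :=
  congrArg (fun f : prodAlg A B ⟶ B => toHom f (a, b))
    ((prodFanIsLimit A B).conePointUniqueUpToIso_hom_comp (prodIsProd A B) ⟨.right⟩)

theorem pair_ext {p q : (A ⨯ B).carrier} (h1 : fst p = fst q) (h2 : snd p = snd q) : p = q := by
  let i := (prodIsProd A B).conePointUniqueUpToIso (prodFanIsLimit A B)
  have hi1 : ∀ r, (toHom i.hom r).1 = fst r := fun r =>
    congrArg (fun f : (A ⨯ B) ⟶ A => toHom f r)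
      ((prodIsProd A B).conePointUniqueUpToIso_hom_comp (prodFanIsLimit A B) ⟨.left⟩)
  have hi2 : ∀ r, (toHom i.hom r).2 = snd r := fun r =>
    congrArg (fun f : (A ⨯ B) ⟶ B => toHom f r)
      ((prodIsProd A B).conePointUniqueUpToIso_hom_comp (prodFanIsLimit A B) ⟨.right⟩)
  have hinv : ∀ r, toHom i.inv (toHom i.hom r) = r := fun r =>
    congrArg (fun f : (A ⨯ B) ⟶ (A ⨯ B) => toHom f r) i.hom_inv_id
  rw [← hinv p, ← hinv q]
  congr 1
  exact Prod.ext (by rw [hi1, hi1, h1]) (by rw [hi2, hi2, h2])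

@[simp]
theorem mkPair_fst_snd (p : (A ⨯ B).carrier) : mkPair (fst p) (snd p) = p :=
  pair_ext (by simp) (by simp)

theorem fst_realize {α : Type*} (t : L.Term α) (a : α → (A ⨯ B).carrier) :
    fst (t.realize a) = t.realize fun i => fst (a i) := toHom_realize _ _ _

theorem snd_realize {α : Type*} (t : L.Term α) (a : α → (A ⨯ B).carrier) :
    snd (t.realize a) = t.realize fun i => snd (a i) := toHom_realize _ _ _

theorem fst_funMap {n : ℕ} (s : L.Functions n) (a : Fin n → (A ⨯ B).carrier) :
    fst (funMap s a) = funMap s fun i => fst (a i) := HomClass.map_fun (toHom prod.fst) s a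

theorem snd_funMap {n : ℕ} (s : L.Functions n) (a : Fin n → (A ⨯ B).carrier) :
    snd (funMap s a) = funMap s fun i => snd (a i) := HomClass.map_fun (toHom prod.snd) s a

@[simp]
theorem fst_map {A' B' : V.Alg} (f : A ⟶ A') (g : B ⟶ B') (p : (A ⨯ B).carrier) :
    fst (toHom (prod.map f g) p) = toHom f (fst p) :=
  congrArg (fun h : (A ⨯ B) ⟶ A' => toHom h p) (prod.map_fst f g)

@[simp]
theorem snd_map {A' B' : V.Alg} (f : A ⟶ A') (g : B ⟶ B') (p : (A ⨯ B).carrier) :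
    snd (toHom (prod.map f g) p) = toHom g (snd p) :=
  congrArg (fun h : (A ⨯ B) ⟶ B' => toHom h p) (prod.map_snd f g)

@[simp]
theorem fst_lift {C : V.Alg} (f : C ⟶ A) (g : C ⟶ B) (c : C.carrier) :
    fst (toHom (prod.lift f g) c) = toHom f c :=
  congrArg (fun h : C ⟶ A => toHom h c) (prod.lift_fst f g)

@[simp]
theorem snd_lift {C : V.Alg} (f : C ⟶ A) (g : C ⟶ B) (c : C.carrier) :
    snd (toHom (prod.lift f g) c) = toHom g c :=
  congrArg (fun h : C ⟶ B => toHom h c) (prod.lift_snd f g)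

end Prod

/-- The quotient of an algebra by a congruence. -/
def quotient (A : V.Alg) (r : Setoid A.carrier)
    (hr : ∀ {n : ℕ} (s : L.Functions n) (x y : Fin n → A.carrier),
      (∀ i, r (x i) (y i)) → r (funMap s x) (funMap s y)) : V.Alg :=
  letI : L.Prestructure r :=
    { toStructure := A.str
      fun_equiv := hr _
      rel_equiv := fun {_} {s} => isEmptyElim s }
  { carrier := Quotient r
    satisfies := fun p hp a => by
      obtain ⟨b, rfl⟩ : ∃ b : ℕ → A.carrier, (fun i => (⟦b i⟧ : Quotient r)) = a :=
        ⟨fun i => (a i).out, funext fun i => Quotient.out_eq _⟩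
      rw [Term.realize_quotient_mk', Term.realize_quotient_mk']
      exact congrArg _ (A.satisfies p hp b) }

/-- The projection to the quotient by a congruence. -/
def toQuotient (A : V.Alg) (r : Setoid A.carrier)
    (hr : ∀ {n : ℕ} (s : L.Functions n) (x y : Fin n → A.carrier),
      (∀ i, r (x i) (y i)) → r (funMap s x) (funMap s y)) : A ⟶ A.quotient r hr :=
  letI : L.Prestructure r :=
    { toStructure := A.str
      fun_equiv := hr _
      rel_equiv := fun {_} {s} => isEmptyElim s }
  ofHom (.ofFun (fun a => (⟦a⟧ : Quotient r)) fun s x => (funMap_quotient_mk' r s x).symm)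

theorem toQuotient_surjective (A : V.Alg) (r : Setoid A.carrier)
    (hr : ∀ {n : ℕ} (s : L.Functions n) (x y : Fin n → A.carrier),
      (∀ i, r (x i) (y i)) → r (funMap s x) (funMap s y)) :
    Function.Surjective (toHom (A.toQuotient r hr)) := fun a => Quotient.exists_rep a

theorem toQuotient_eq_iff (A : V.Alg) (r : Setoid A.carrier)
    (hr : ∀ {n : ℕ} (s : L.Functions n) (x y : Fin n → A.carrier),
      (∀ i, r (x i) (y i)) → r (funMap s x) (funMap s y)) (a b : A.carrier) :
    toHom (A.toQuotient r hr) a = toHom (A.toQuotient r hr) b ↔ r a b := Quotient.eq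

/-- A subalgebra as an algebra. -/
def ofSubstructure (A : V.Alg) (S : L.Substructure A.carrier) : V.Alg where
  carrier := S
  satisfies p hp a := by
    refine Subtype.ext ?_
    have h : ∀ t : L.Term ℕ,
        (Subtype.val (t.realize a) : A.carrier) = t.realize (Subtype.val ∘ a) :=
      fun t => (HomClass.realize_term S.subtype).symm
    rw [h, h, A.satisfies p hp]

/-- The inclusion of a subalgebra. -/
def subtypeHom (A : V.Alg) (S : L.Substructure A.carrier) : A.ofSubstructure S ⟶ A :=
  ofHom S.subtype.toHom

/-- A morphism into a subalgebra. -/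
def codRestrict {A B : V.Alg} (S : L.Substructure A.carrier) (f : B ⟶ A)
    (hf : ∀ b, toHom f b ∈ S) : B ⟶ A.ofSubstructure S :=
  ofHom (.ofFun (fun b => (⟨toHom f b, hf b⟩ : S)) fun s x =>
    Subtype.ext (HomClass.map_fun (toHom f) s x))

/-- A map between algebras that composes with a surjective morphism to a morphism is itself
one. -/
def descend {A B C : V.Alg} (p : A ⟶ B) (hp : Function.Surjective (toHom p))
    (g : B.carrier → C.carrier) (f : A ⟶ C) (h : ∀ a, g (toHom p a) = toHom f a) : B ⟶ C :=
  ofHom (.ofFun g fun s x => by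
    obtain ⟨y, rfl⟩ : ∃ y : _ → A.carrier, toHom p ∘ y = x :=
      ⟨fun i => (hp (x i)).choose, funext fun i => (hp (x i)).choose_spec⟩
    rw [← HomClass.map_fun, h, HomClass.map_fun]
    congr 1
    funext i
    exact (h _).symm)

end Alg

/-! ### Term algebras modulo congruences, and free algebras. -/

/-- A congruence on the algebra of terms whose quotient lies in the variety. -/
structure TermCongruence (V : Variety L) (α : Type) extends Setoid (L.Term α) where
  func : ∀ {n : ℕ} (s : L.Functions n) (x y : Fin n → L.Term α),
    (∀ i, r (x i) (y i)) → r (.func s x) (.func s y)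
  of_holds : ∀ {s t : L.Term α}, V.Holds s t → r s t

namespace TermCongruence

variable {α : Type} (r : V.TermCongruence α)

@[reducible]
def prestructure : L.Prestructure r.toSetoid where
  toStructure := termStructure L α
  fun_equiv := r.func _
  rel_equiv {_} {s} := isEmptyElim s

/-- The quotient of the algebra of terms by a congruence. -/
def quot : V.Alg :=
  letI := r.prestructure
  { carrier := Quotient r.toSetoid
    satisfies := fun p hp a => by
      obtain ⟨b, rfl⟩ : ∃ b : ℕ → L.Term α, (fun i => (⟦b i⟧ : Quotient r.toSetoid)) = a :=
        ⟨fun i => (a i).out, funext fun i => Quotient.out_eq _⟩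
      rw [Term.realize_quotient_mk', Term.realize_quotient_mk', Term.realize_termStructure,
        Term.realize_termStructure]
      -- Substituting terms into a defining identity yields an identity of `V`, and `of_holds`
      -- places it in the congruence.
      refine Quotient.sound (r.of_holds fun A x => ?_)
      rw [Term.realize_subst, Term.realize_subst]
      exact A.satisfies p hp _ }

/-- The class of a term. -/
def cls (t : L.Term α) : r.quot.carrier := (⟦t⟧ : Quotient r.toSetoid)

theorem cls_surjective : Function.Surjective r.cls := fun a => Quotient.exists_rep a

theorem cls_eq_iff {s t : L.Term α} : r.cls s = r.cls t ↔ r.toSetoid s t := Quotient.eq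

theorem realize_cls {β : Type*} (t : L.Term β) (σ : β → L.Term α) :
    t.realize (fun i => r.cls (σ i)) = r.cls (t.subst σ) := by
  let := r.prestructure
  rw [← Term.realize_termStructure]
  exact Term.realize_quotient_mk' r.toSetoid t σ

theorem funMap_cls {n : ℕ} (s : L.Functions n) (x : Fin n → L.Term α) :
    funMap s (fun i => r.cls (x i)) = r.cls (.func s x) := by
  let := r.prestructure
  exact funMap_quotient_mk' r.toSetoid s x

theorem realize_cls_var (t : L.Term α) : t.realize (fun i => r.cls (.var i)) = r.cls t := by
  rw [realize_cls]
  congr 1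
  induction t with
  | var => rfl
  | func f ts ih => exact congrArg _ (funext ih)

/-- The morphism out of the quotient induced by an assignment of the variables. -/
def lift {A : V.Alg} (a : α → A.carrier)
    (ha : ∀ s t, r.toSetoid s t → s.realize a = t.realize a) : r.quot ⟶ A :=
  Alg.ofHom (.ofFun (Quotient.lift (s := r.toSetoid) (fun t => t.realize a) ha) fun s x => by
    obtain ⟨y, rfl⟩ : ∃ y : _ → L.Term α, (fun i => r.cls (y i)) = x :=
      ⟨fun i => (r.cls_surjective (x i)).choose,
        funext fun i => (r.cls_surjective (x i)).choose_spec⟩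
    rw [funMap_cls]
    rfl)

/-- The congruence of the identities that hold in the variety. -/
def free (V : Variety L) (α : Type) : V.TermCongruence α where
  r s t := V.Holds s t
  iseqv := ⟨fun _ _ _ => rfl, fun h A a => (h A a).symm, fun h k A a => (h A a).trans (k A a)⟩
  func s _ _ h A a := congrArg (funMap s) (funext fun i => h i A a)
  of_holds := id

/-- The morphism out of a free algebra. -/
def freeLift {A : V.Alg} (a : α → A.carrier) : (free V α).quot ⟶ A :=
  (free V α).lift a fun _ _ h => h A a

end TermCongruence

namespace Alg

/-- The value of a closed term in an algebra. -/
def const (A : V.Alg) (e : L.Term Empty) : A.carrier := e.realize Empty.elim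

@[simp]
theorem realize_closedTerm (A : V.Alg) {α : Type*} (e : L.Term Empty) (a : α → A.carrier) :
    (closedTerm e : L.Term α).realize a = A.const e := by
  rw [closedTerm, Term.realize_relabel]
  exact congrArg (fun b => e.realize b) (funext fun i => i.elim)

theorem const_eq_realize (A : V.Alg) (e : L.Term Empty) (a : Empty → A.carrier) :
    e.realize a = A.const e :=
  congrArg (fun b => e.realize b) (funext fun i => i.elim)

@[simp]
theorem toHom_const {A B : V.Alg} (f : A ⟶ B) (e : L.Term Empty) :
    toHom f (A.const e) = B.const e :=
  (toHom_realize f e _).trans (B.const_eq_realize e _)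

@[simp]
theorem fst_const {A B : V.Alg} (e : L.Term Empty) : fst ((A ⨯ B).const e) = A.const e :=
  toHom_const _ _

@[simp]
theorem snd_const {A B : V.Alg} (e : L.Term Empty) : snd ((A ⨯ B).const e) = B.const e :=
  toHom_const _ _

end Alg

open Alg

/-! ### The relation `≃ₜ` as a congruence on terms. -/

namespace DiagonalisingTerm

variable (D : V.DiagonalisingTerm)

/-- The operation `(a, b) ↦ t(a, b, c₁, …, cₖ)` on an algebra. -/
def op {A : V.Alg} (c : Fin D.k → A.carrier) (a b : A.carrier) : A.carrier :=
  D.t.realize (Sum.elim ![a, b] c)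

theorem realize_diagApply {A : V.Alg} {α : Type*} (a b : L.Term α) (d : Fin D.k → L.Term α)
    (x : α → A.carrier) :
    (diagApply D.t a b d).realize x =
      D.op (fun i => (d i).realize x) (a.realize x) (b.realize x) := by
  rw [diagApply, Term.realize_subst, op]
  congr 1
  funext i
  rcases i with i | i
  · fin_cases i <;> rfl
  · rfl

@[simp]
theorem op_const_e {A : V.Alg} (a b : A.carrier) : D.op (fun i => A.const (D.e i)) a b = a := by
  have := D.holds_fst A ![a, b]
  rwa [realize_diagApply, funext fun i => A.realize_closedTerm (D.e i) _] at this

@[simp]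
theorem op_const_e' {A : V.Alg} (a b : A.carrier) : D.op (fun i => A.const (D.e' i)) a b = b := by
  have := D.holds_snd A ![a, b]
  rwa [realize_diagApply, funext fun i => A.realize_closedTerm (D.e' i) _] at this

theorem toHom_op {A B : V.Alg} (f : A ⟶ B) (c : Fin D.k → A.carrier) (a b : A.carrier) :
    toHom f (D.op c a b) = D.op (fun i => toHom f (c i)) (toHom f a) (toHom f b) := by
  rw [op, toHom_realize, op]
  congr 1
  funext i
  rcases i with i | i
  · fin_cases i <;> rfl
  · rfl

theorem fst_op {A B : V.Alg} (c : Fin D.k → (A ⨯ B).carrier) (a b : (A ⨯ B).carrier) :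
    fst (D.op c a b) = D.op (fun i => fst (c i)) (fst a) (fst b) := D.toHom_op _ _ _ _

theorem snd_op {A B : V.Alg} (c : Fin D.k → (A ⨯ B).carrier) (a b : (A ⨯ B).carrier) :
    snd (D.op c a b) = D.op (fun i => snd (c i)) (snd a) (snd b) := D.toHom_op _ _ _ _

theorem realize_diagSplit {A : V.Alg} (v : L.Term (Fin D.k)) (c : Fin D.k → A.carrier) :
    (D.diagSplit v).realize c =
      D.op c (v.realize fun i => A.const (D.e i)) (v.realize fun i => A.const (D.e' i)) := by
  rw [diagSplit, realize_diagApply, Term.realize_subst, Term.realize_subst]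
  simp only [realize_closedTerm]
  rfl

theorem realize_diagSplit_e {A : V.Alg} (v : L.Term (Fin D.k)) :
    (D.diagSplit v).realize (fun i => A.const (D.e i)) = v.realize fun i => A.const (D.e i) := by
  rw [realize_diagSplit, op_const_e]

theorem realize_diagSplit_e' {A : V.Alg} (v : L.Term (Fin D.k)) :
    (D.diagSplit v).realize (fun i => A.const (D.e' i)) = v.realize fun i => A.const (D.e' i) := by
  rw [realize_diagSplit, op_const_e']

/-- `diagSplit v` depends only on the values of `v` at `e` and at `e'`, and it has the same values
there. -/
theorem holds_diagSplit_diagSplit (v : L.Term (Fin D.k)) :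
    V.Holds (D.diagSplit (D.diagSplit v)) (D.diagSplit v) := fun A c => by
  rw [realize_diagSplit, realize_diagSplit_e, realize_diagSplit_e', realize_diagSplit]

theorem holds_diagSplit_congr {v w : L.Term (Fin D.k)} (h : V.Holds v w) :
    V.Holds (D.diagSplit v) (D.diagSplit w) := fun A c => by
  rw [realize_diagSplit, realize_diagSplit, h A, h A]

theorem realize_plug {A : V.Alg} {X : Type w} {k m m' : ℕ} (u : L.Term (Fin m ⊕ Fin m'))
    (x : Fin m → X) (v : Fin m' → L.Term (Fin k)) (z : X → A.carrier) (c : Fin k → A.carrier) :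
    (plug u x v).realize (Sum.elim z c) =
      u.realize (Sum.elim (fun i => z (x i)) fun j => (v j).realize c) := by
  rw [plug, Term.realize_subst]
  congr 1
  funext i
  rcases i with i | i
  · rfl
  · exact Term.realize_relabel

/-- The pairs `(w, v)` of terms that may be substituted for each other in `Sim`. -/
def SplitPair : Type u :=
  {p : L.Term (Fin D.k) × L.Term (Fin D.k) //
    V.Holds p.2 (D.diagSplit p.1) ∨ V.Holds p.1 (D.diagSplit p.2)}

namespace SplitPair

variable {D}

/-- The first term of a pair. -/
def left (p : D.SplitPair) : L.Term (Fin D.k) := p.1.1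

/-- The second term of a pair. -/
def right (p : D.SplitPair) : L.Term (Fin D.k) := p.1.2

/-- The pair `(w, t(w(e), w(e'), c))`. -/
def toSplit (w : L.Term (Fin D.k)) : D.SplitPair := ⟨(w, D.diagSplit w), .inl fun _ _ => rfl⟩

/-- The pair `(t(w(e), w(e'), c), w)`. -/
def ofSplit (w : L.Term (Fin D.k)) : D.SplitPair := ⟨(D.diagSplit w, w), .inr fun _ _ => rfl⟩

/-- The pair obtained from `(w, v)` by replacing `w` with `t(w(e), w(e'), c)`. -/
def splitLeft (p : D.SplitPair) : D.SplitPair :=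
  ⟨(D.diagSplit p.left, p.right), by
    rcases p.2 with h | h
    · exact .inl fun A c => (h A c).trans (D.holds_diagSplit_diagSplit _ A c).symm
    · exact .inr fun A c => (D.holds_diagSplit_congr h A c).trans
        (D.holds_diagSplit_diagSplit _ A c)⟩

/-- The pair `(v, w)`. -/
def swap (p : D.SplitPair) : D.SplitPair := ⟨(p.right, p.left), p.2.symm⟩

end SplitPair

theorem realize_relabel_inr {A : V.Alg} {X : Type*} {β : Type*} (t : L.Term β) (x : X → A.carrier)
    (c : β → A.carrier) : (t.relabel .inr).realize (Sum.elim x c) = t.realize c :=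
  Term.realize_relabel

variable {X : Type}

/-- One step of the relation `≃ₜ`: simultaneously replace the first terms of some pairs by the
second terms. -/
def Step (α β : L.Term (X ⊕ Fin D.k)) : Prop :=
  ∃ u : L.Term (X ⊕ D.SplitPair), ∀ (A : V.Alg) (x : X → A.carrier) (c : Fin D.k → A.carrier),
    u.realize (Sum.elim x fun p => p.left.realize c) = α.realize (Sum.elim x c) ∧
    u.realize (Sum.elim x fun p => p.right.realize c) = β.realize (Sum.elim x c)

/-- As `Step`, but allowing the variables `c` in the context. -/
def ContextStep (α β : L.Term (X ⊕ Fin D.k)) : Prop :=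
  ∃ u : L.Term ((X ⊕ Fin D.k) ⊕ D.SplitPair),
    ∀ (A : V.Alg) (x : X → A.carrier) (c : Fin D.k → A.carrier),
      u.realize (Sum.elim (Sum.elim x c) fun p => p.left.realize c) = α.realize (Sum.elim x c) ∧
      u.realize (Sum.elim (Sum.elim x c) fun p => p.right.realize c) = β.realize (Sum.elim x c)

variable {D} {α β : L.Term (X ⊕ Fin D.k)}

theorem ContextStep.of_holds (h : V.Holds α β) : D.ContextStep α β :=
  ⟨α.relabel Sum.inl, fun A _ _ =>
    ⟨Term.realize_relabel, Term.realize_relabel.trans (h A _)⟩⟩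

theorem ContextStep.refl (α : L.Term (X ⊕ Fin D.k)) : D.ContextStep α α :=
  .of_holds fun _ _ => rfl

theorem ContextStep.symm (h : D.ContextStep α β) : D.ContextStep β α := by
  obtain ⟨u, hu⟩ := h
  refine ⟨u.relabel (Sum.map id SplitPair.swap), fun A x c => ⟨?_, ?_⟩⟩
  · rw [Term.realize_relabel, Sum.elim_comp_map, ← (hu A x c).2]
    rfl
  · rw [Term.realize_relabel, Sum.elim_comp_map, ← (hu A x c).1]
    rfl

theorem ContextStep.func {n : ℕ} (s : L.Functions n) {a b : Fin n → L.Term (X ⊕ Fin D.k)}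
    (h : ∀ i, D.ContextStep (a i) (b i)) : D.ContextStep (.func s a) (.func s b) := by
  choose u hu using h
  exact ⟨.func s u, fun A x c => ⟨congrArg (funMap s) (funext fun i => (hu i A x c).1),
    congrArg (funMap s) (funext fun i => (hu i A x c).2)⟩⟩

/-- The obstacle is that a bare `cᵢ` in the context is not available in `Step`, where `c` occurs
only inside split pairs. Two steps remove it: the first replaces each `cᵢ` by `t(eᵢ,eᵢ',c)` and each
left term `w` by `t(w(e),w(e'),c)`. The second restores `cᵢ` and moves to the right term, which is
legitimate because `splitLeft` is again a split pair. -/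
theorem ContextStep.transGen_step (h : D.ContextStep α β) :
    Relation.TransGen D.Step α β := by
  obtain ⟨u, hu⟩ := h
  refine .tail (b := u.subst (Sum.elim
      (Sum.elim (fun x => .var (.inl x)) fun i => (D.diagSplit (.var i)).relabel .inr)
      fun p => (D.diagSplit p.left).relabel .inr)) (.single ?_) ?_
  · refine ⟨u.relabel (Sum.elim (Sum.map id fun i => SplitPair.toSplit (.var i))
      fun p => .inr (.toSplit p.left)), fun A x c => ⟨?_, ?_⟩⟩
    · rw [Term.realize_relabel, ← (hu A x c).1]
      congr 1
      funext i
      rcases i with (i | i) | i <;> rfl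
    · rw [Term.realize_relabel, Term.realize_subst]
      congr 1
      funext i
      rcases i with (i | i) | i
      · rfl
      · exact (realize_relabel_inr _ x c).symm
      · exact (realize_relabel_inr _ x c).symm
  · refine ⟨u.relabel (Sum.elim (Sum.map id fun i => SplitPair.ofSplit (.var i))
      fun p => .inr p.splitLeft), fun A x c => ⟨?_, ?_⟩⟩
    · rw [Term.realize_relabel, Term.realize_subst]
      congr 1
      funext i
      rcases i with (i | i) | i
      · rfl
      · exact (realize_relabel_inr _ x c).symm
      · exact (realize_relabel_inr _ x c).symm
    · rw [Term.realize_relabel, ← (hu A x c).2]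
      congr 1
      funext i
      rcases i with (i | i) | i <;> rfl

theorem exists_chain_of_transGen_step (h : Relation.TransGen D.Step α β) :
    ∃ (n : ℕ) (u : Fin (n + 1) → L.Term (X ⊕ D.SplitPair)),
      ∀ (A : V.Alg) (x : X → A.carrier) (c : Fin D.k → A.carrier),
        (u 0).realize (Sum.elim x fun p => p.left.realize c) = α.realize (Sum.elim x c) ∧
        (∀ i : Fin n, (u i.castSucc).realize (Sum.elim x fun p => p.right.realize c) =
          (u i.succ).realize (Sum.elim x fun p => p.left.realize c)) ∧
        (u (Fin.last n)).realize (Sum.elim x fun p => p.right.realize c) =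
          β.realize (Sum.elim x c) := by
  induction h using Relation.TransGen.head_induction_on with
  | single h =>
    obtain ⟨u, hu⟩ := h
    exact ⟨0, fun _ => u, fun A x c => ⟨(hu A x c).1, fun i => i.elim0, (hu A x c).2⟩⟩
  | head h _ ih =>
    obtain ⟨u₀, hu₀⟩ := h
    obtain ⟨n, u, hu⟩ := ih
    refine ⟨n + 1, Fin.cons u₀ u, fun A x c => ⟨(hu₀ A x c).1, fun i => ?_, (hu A x c).2.2⟩⟩
    refine Fin.cases ?_ (fun i => ?_) i
    · exact (hu₀ A x c).2.trans (hu A x c).1.symm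
    · exact (hu A x c).2.1 i

/-- The chain involves finitely many terms, so one finite list of variables and split pairs serves
all of them at once. -/
theorem Sim.of_transGen_step (h : Relation.TransGen D.Step α β) : D.Sim α β := by
  obtain ⟨n, u, hu⟩ := exists_chain_of_transGen_step h
  obtain ⟨m, m', x, p, u', hu'⟩ := Term.exists_relabel_sum_of_finite u
  have key : ∀ (A : V.Alg) (z : X ⊕ Fin D.k → A.carrier) (f : D.SplitPair → L.Term (Fin D.k)) i,
      (plug (u' i) x fun j => f (p j)).realize z =
        (u i).realize (Sum.elim (z ∘ .inl) fun j => (f j).realize (z ∘ .inr)) := by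
    intro A z f i
    rw [← Sum.elim_comp_inl_inr z, realize_plug, ← hu' i, Term.realize_relabel]
    congr 1
    funext i
    rcases i with i | i <;> rfl
  refine ⟨n, m, m', x, u', fun j => (p j).right, fun j => (p j).left, fun A z => ?_,
    fun i A z => ?_, fun A z => ?_, fun j => (p j).2⟩
  · rw [key, (hu A _ _).1, Sum.elim_comp_inl_inr]
  · rw [key, key, (hu A _ _).2.1]
  · rw [key, (hu A _ _).2.2, Sum.elim_comp_inl_inr]

/-- Even reflexivity needs an argument: a chain contains at least one `u`, and `α` itself may not
serve as `u` because it can involve `c`. The detour through `ContextStep.refl` covers this. -/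
theorem transGen_step_of_reflTransGen (h : Relation.ReflTransGen D.ContextStep α β) :
    Relation.TransGen D.Step α β := by
  induction h with
  | refl => exact (ContextStep.refl α).transGen_step
  | tail _ h ih => exact ih.trans h.transGen_step

variable (D X)

/-- The congruence generated by `v(c) ∼ t(v(e), v(e'), c)`. -/
def simCongruence : V.TermCongruence (X ⊕ Fin D.k) where
  r := Relation.ReflTransGen D.ContextStep
  iseqv :=
    ⟨fun _ => .refl,
      fun h => have : Std.Symm (D.ContextStep (X := X)) := ⟨fun _ _ h => h.symm⟩; symm h,
      fun h h' => h.trans h'⟩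
  func {n} s a b h := by
    classical
    -- The chains for different arguments may have different lengths, so the arguments are changed
    -- one at a time; `S` is the set of those already changed.
    have aux : ∀ S : Finset (Fin n), Relation.ReflTransGen D.ContextStep
        (.func s a) (.func s (S.piecewise b a)) := by
      intro S
      induction S using Finset.induction_on with
      | empty => rw [Finset.piecewise_empty]
      | insert i S hi ih =>
        refine ih.trans ?_
        rw [Finset.piecewise_insert]
        have : Relation.ReflTransGen D.ContextStep
            (.func s (Function.update (S.piecewise b a) i (a i)))
            (.func s (Function.update (S.piecewise b a) i (b i))) := by
          refine Relation.ReflTransGen.lift (p := D.ContextStep)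
            (fun t => .func s (Function.update (S.piecewise b a) i t)) (fun t t' h => ?_) _ _ (h i)
          refine ContextStep.func s fun j => ?_
          rcases eq_or_ne j i with rfl | hj
          · simpa using h
          · simpa [hj] using ContextStep.refl _
        rwa [Function.update_eq_self_iff.2 (Finset.piecewise_eq_of_notMem S b a hi).symm] at this
    simpa using aux Finset.univ
  of_holds h := .single (.of_holds h)

variable {D X}

theorem Sim.of_simCongruence (h : (D.simCongruence X).toSetoid α β) : D.Sim α β :=
  .of_transGen_step (transGen_step_of_reflTransGen h)

theorem cls_diagSplit (v : L.Term (Fin D.k)) :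
    (D.simCongruence X).cls ((D.diagSplit v).relabel .inr) =
      (D.simCongruence X).cls (v.relabel .inr) := by
  refine (TermCongruence.cls_eq_iff _).2 (Relation.ReflTransGen.single
    ⟨.var (.inr (.ofSplit v)), fun A x c => ⟨?_, ?_⟩⟩)
  · exact (realize_relabel_inr _ x c).symm
  · exact (realize_relabel_inr _ x c).symm

/-- Related terms become equal when the variables `c` take values at which each term `v(c)` agrees
with `t(v(e), v(e'), c)`. -/
theorem realize_eq_of_sim {X : Type w} {α β : L.Term (X ⊕ Fin D.k)} (h : D.Sim α β)
    {A : V.Alg} (c : Fin D.k → A.carrier)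
    (hc : ∀ v : L.Term (Fin D.k), (D.diagSplit v).realize c = v.realize c) (x : X → A.carrier) :
    α.realize (Sum.elim x c) = β.realize (Sum.elim x c) := by
  obtain ⟨n, m, m', z, u, v, w, h0, hi, hl, hvw⟩ := h
  have hvw' : ∀ j, (v j).realize c = (w j).realize c := fun j => by
    rcases hvw j with h | h
    · exact (h A c).trans (hc _)
    · exact ((h A c).trans (hc _)).symm
  have key : ∀ i, (plug (u i) z w).realize (Sum.elim x c) =
      (plug (u i) z v).realize (Sum.elim x c) := fun i => by
    rw [realize_plug, realize_plug, funext hvw']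
  have all : ∀ i, (plug (u i) z w).realize (Sum.elim x c) = α.realize (Sum.elim x c) := by
    intro i
    induction i using Fin.induction with
    | zero => exact h0 A _
    | succ i ih => rw [← hi i A, ← key, ih]
  rw [← all (Fin.last n), key, hl A]

end DiagonalisingTerm

/-! ### The initial algebra, and the diagonalising term obtained from coextensivity. -/

section InitialAlgebra

/-- The initial algebra, consisting of the classes of closed terms. -/
def initial (V : Variety L) : V.Alg := (TermCongruence.free V Empty).quot

/-- The unique morphism from the initial algebra. -/
def fromInitial (A : V.Alg) : V.initial ⟶ A := TermCongruence.freeLift Empty.elim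

theorem exists_const_initial (a : V.initial.carrier) : ∃ e, V.initial.const e = a := by
  obtain ⟨e, rfl⟩ := (TermCongruence.free V Empty).cls_surjective a
  exact ⟨e, (Alg.const_eq_realize _ e _).symm.trans (TermCongruence.realize_cls_var _ e)⟩

end InitialAlgebra

section Coextensive

variable [IsCoextensive V.Alg]

/-- Essential surjectivity splits `Z`, and fullness then splits `φ`, regarded as a morphism under `X
⨯ Y`. -/
theorem exists_decomposition {X Y Z A' B' : V.Alg} (h : X ⨯ Y ⟶ Z) (f : X ⟶ A') (g : Y ⟶ B')
    (φ : Z ⟶ A' ⨯ B') (hφ : h ≫ φ = prod.map f g) :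
    ∃ (A B : V.Alg) (θ : Z ≅ A ⨯ B) (a : A ⟶ A') (b : B ⟶ B'), φ = θ.hom ≫ prod.map a b := by
  have := IsCoextensive.isEquivalence X Y
  let F := underProdFunctor X Y
  let P := F.objPreimage (Under.mk h)
  let e : F.obj P ≅ Under.mk h := F.objObjPreimageIso (Under.mk h)
  let m : F.obj P ⟶ F.obj (Under.mk f, Under.mk g) :=
    e.hom ≫ Under.homMk (U := Under.mk h) (V := F.obj (Under.mk f, Under.mk g)) φ hφ
  refine ⟨P.1.right, P.2.right, (Under.forget _).mapIso e.symm,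
    (F.preimage m).1.right, (F.preimage m).2.right, ?_⟩
  have h1 : prod.map (F.preimage m).1.right (F.preimage m).2.right = e.hom.right ≫ φ :=
    congrArg (fun k => k.right) (F.map_preimage m)
  rw [h1]
  exact ((Under.forget _).mapIso e).inv_hom_id_assoc φ |>.symm

/-- Without closed terms the initial algebra `0` is empty, and so is `0 × 1`. The empty map `0 × 1 →
0 × 0` would come by fullness from a pair of morphisms, one of them `1 → 0`, which is impossible. -/
theorem nonempty_closedTerm (V : Variety L) [IsCoextensive V.Alg] : Nonempty (L.Term Empty) := by
  by_contra hne
  have hE : ∀ a : V.initial.carrier, False := fun a => hne ⟨(exists_const_initial a).choose⟩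
  let F := underProdFunctor V.initial V.initial
  have : F.IsEquivalence := IsCoextensive.isEquivalence _ _
  let P : Under V.initial × Under V.initial :=
    (Under.mk (𝟙 _), Under.mk (fromInitial (punitAlg V)))
  let Q : Under V.initial × Under V.initial := (Under.mk (𝟙 _), Under.mk (𝟙 _))
  let m : F.obj P ⟶ F.obj Q := Under.homMk
    (ofHom (.ofFun (fun p : (V.initial ⨯ punitAlg V).carrier => (hE (fst p)).elim)
      fun {n} (s : L.Functions n) x => (hE (fst (funMap s x))).elim))
    (hom_ext fun p => (hE (fst p)).elim)
  exact hE (toHom (A := punitAlg V) (B := V.initial) (F.preimage m).2.right PUnit.unit)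

theorem exists_diagonalisingTerm : Nonempty V.DiagonalisingTerm := by
  obtain ⟨e₀⟩ := nonempty_closedTerm V
  let F := (TermCongruence.free V (Fin 2)).quot
  let x : Fin 2 → F.carrier := fun i => (TermCongruence.free V (Fin 2)).cls (.var i)
  let g : Fin 2 ⊕ (L.Term Empty × L.Term Empty) → (F ⨯ F).carrier :=
    Sum.elim (fun i => mkPair (x i) (x i)) fun c => mkPair (F.const c.1) (F.const c.2)
  let S := Substructure.closure L (Set.range g)
  have hg : ∀ i, g i ∈ S := fun i => Substructure.subset_closure ⟨i, rfl⟩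
  have hS : ∀ p, toHom (prod.map (fromInitial F) (fromInitial F)) p ∈ S := by
    intro p
    obtain ⟨a, ha⟩ := exists_const_initial (fst p)
    obtain ⟨b, hb⟩ := exists_const_initial (snd p)
    convert hg (.inr (a, b)) using 1
    refine pair_ext ?_ ?_
    · rw [fst_map, ← ha, toHom_const]
      exact (fst_mkPair _ _).symm
    · rw [snd_map, ← hb, toHom_const]
      exact (snd_mkPair _ _).symm
  -- Since the inclusion of `S` is a product map up to isomorphism, `S` is closed under combining
  -- the first component of one element with the second of another.
  have hxy : mkPair (x 0) (x 1) ∈ S := by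
    obtain ⟨A, B, θ, a, b, hφ⟩ := exists_decomposition
      (codRestrict S (prod.map (fromInitial F) (fromInitial F)) hS)
      (fromInitial F) (fromInitial F) (subtypeHom _ S) rfl
    have hφ' : ∀ s : S, (s : (F ⨯ F).carrier) = toHom (prod.map a b) (toHom θ.hom s) :=
      fun s => congrArg (fun k : (F ⨯ F).ofSubstructure S ⟶ F ⨯ F => toHom k s) hφ
    let q : Fin 2 → (A ⨯ B).carrier := fun i => toHom θ.hom (⟨g (.inl i), hg _⟩ : S)
    have hq : ∀ i, toHom (prod.map a b) (q i) = mkPair (x i) (x i) :=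
      fun i => (hφ' ⟨g (.inl i), hg _⟩).symm
    let s : S := toHom θ.inv (mkPair (fst (q 0)) (snd (q 1)))
    have hs : toHom θ.hom s = mkPair (fst (q 0)) (snd (q 1)) :=
      congrArg (fun k : A ⨯ B ⟶ A ⨯ B => toHom k _) θ.inv_hom_id
    convert s.2 using 1
    rw [hφ', hs]
    refine pair_ext ?_ ?_
    · rw [fst_map, fst_mkPair, fst_mkPair, ← fst_map a b, hq, fst_mkPair]
    · rw [snd_map, snd_mkPair, snd_mkPair, ← snd_map a b, hq, snd_mkPair]
  obtain ⟨t, ht⟩ := Substructure.mem_closure_iff_exists_term.1 hxy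
  -- Each generator is replaced by an index for it, so that the variables separate into copies of
  -- `x₀, x₁` and pairs of constants.
  obtain ⟨m, n, y, c, t', ht'⟩ := Term.exists_relabel_sum_of_finite
    fun _ : Unit => t.relabel fun s => s.2.choose
  have key : (t' ()).realize (g ∘ Sum.map y c) = mkPair (x 0) (x 1) := by
    rw [← Term.realize_relabel, ht', Term.realize_relabel, ← ht]
    congr 1
    funext s
    exact s.2.choose_spec
  -- The number `n` of pairs of constants used may be zero; the dummy constant `e₀` in front, which
  -- the term ignores, ensures `k ≥ 1`.
  refine ⟨⟨n + 1, by omega, (t' ()).relabel (Sum.map y Fin.succ),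
    Fin.cons e₀ fun i => (c i).1, Fin.cons e₀ fun i => (c i).2, fun A a => ?_, fun A a => ?_⟩⟩
  · have h1 := congrArg (toHom (TermCongruence.freeLift a) ∘ fst) key
    simp only [Function.comp_apply, fst_realize, toHom_realize, fst_mkPair] at h1
    refine Eq.trans ?_ h1
    rw [diagApply, Term.realize_subst, Term.realize_relabel]
    congr 1
    funext i
    rcases i with i | i
    · simp only [Function.comp_apply, Sum.map_inl, g, Sum.elim_inl, fst_mkPair]
      generalize y i = j
      fin_cases j <;> rfl
    · simpa [g] using (toHom_const _ _).symm
  · have h1 := congrArg (toHom (TermCongruence.freeLift a) ∘ snd) key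
    simp only [Function.comp_apply, snd_realize, toHom_realize, snd_mkPair] at h1
    refine Eq.trans ?_ h1
    rw [diagApply, Term.realize_subst, Term.realize_relabel]
    congr 1
    funext i
    rcases i with i | i
    · simp only [Function.comp_apply, Sum.map_inl, g, Sum.elim_inl, snd_mkPair]
      generalize y i = j
      fin_cases j <;> rfl
    · simpa [g] using (toHom_const _ _).symm

end Coextensive

/-! ### Coextensivity implies conditions 2 and 3 for every diagonalising term. -/

namespace DiagonalisingTerm

variable (D : V.DiagonalisingTerm)

/-- The elements `(eᵢ, eᵢ')` of a product. -/
def splitConst (A B : V.Alg) (i : Fin D.k) : (A ⨯ B).carrier :=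
  mkPair (A.const (D.e i)) (B.const (D.e' i))

@[simp]
theorem fst_splitConst (A B : V.Alg) (i : Fin D.k) :
    fst (D.splitConst A B i) = A.const (D.e i) := fst_mkPair _ _

@[simp]
theorem snd_splitConst (A B : V.Alg) (i : Fin D.k) :
    snd (D.splitConst A B i) = B.const (D.e' i) := snd_mkPair _ _

@[simp]
theorem map_splitConst {A B A' B' : V.Alg} (f : A ⟶ A') (g : B ⟶ B') (i : Fin D.k) :
    toHom (prod.map f g) (D.splitConst A B i) = D.splitConst A' B' i :=
  pair_ext (by simp) (by simp)

@[simp]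
theorem op_splitConst {A B : V.Alg} (p q : (A ⨯ B).carrier) :
    D.op (D.splitConst A B) p q = mkPair (fst p) (snd q) :=
  pair_ext (by simp [fst_op]) (by simp [snd_op])

/-- In each factor the parameters are `e` or `e'`, where splitting changes nothing. Hence `(e,e')`
satisfies all the relations generating `≃ₜ`. -/
theorem realize_diagSplit_splitConst {A B : V.Alg} (v : L.Term (Fin D.k)) :
    (D.diagSplit v).realize (D.splitConst A B) = v.realize (D.splitConst A B) :=
  pair_ext (by simp [fst_realize, realize_diagSplit_e])
    (by simp [snd_realize, realize_diagSplit_e'])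

section SimQuotient

variable (X : Type)

/-- The free algebra on variables `X` and `c` modulo `≃ₜ`. -/
def simQuot : V.Alg := (D.simCongruence X).quot

/-- The generators `c`. -/
def simConst (i : Fin D.k) : (D.simQuot X).carrier := (D.simCongruence X).cls (.var (.inr i))

theorem realize_diagSplit_simConst (v : L.Term (Fin D.k)) :
    (D.diagSplit v).realize (D.simConst X) = v.realize (D.simConst X) := by
  have h : ∀ t : L.Term (Fin D.k),
      t.realize (D.simConst X) = (D.simCongruence X).cls (t.relabel .inr) := fun t => by
    rw [← TermCongruence.realize_cls_var, Term.realize_relabel]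
    rfl
  rw [h, h, cls_diagSplit]

/-- The morphism from the square of the initial algebra sending `(eᵢ, eᵢ')` to `cᵢ`. -/
def initialProdToSimQuot : V.initial ⨯ V.initial ⟶ D.simQuot X :=
  ofHom (.ofFun (fun p => D.op (D.simConst X) (toHom (fromInitial _) (fst p))
    (toHom (fromInitial _) (snd p))) fun {n} s x => by
      choose a ha using fun i => exists_const_initial (fst (x i))
      choose b hb using fun i => exists_const_initial (snd (x i))
      -- For `v = s(t(a₁,b₁,c), …)` one has `v(e) = s(a)` and `v(e') = s(b)`, so the relation `v(c)
      -- = t(v(e),v(e'),c)` is exactly compatibility with `s`.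
      have h := D.realize_diagSplit_simConst X
        (.func s fun i => diagApply D.t (closedTerm (a i)) (closedTerm (b i)) .var)
      simp only [realize_diagSplit, Term.realize_func, realize_diagApply, realize_closedTerm,
        Term.realize_var, op_const_e, op_const_e'] at h
      simp only [fst_funMap, snd_funMap, HomClass.map_fun]
      convert h using 2
      · congr 1
        funext i
        simp [← ha]
      · congr 1
        funext i
        simp [← hb]
      · funext i
        simp [← ha, ← hb])

theorem initialProdToSimQuot_splitConst (i : Fin D.k) :
    toHom (D.initialProdToSimQuot X) (D.splitConst _ _ i) = D.simConst X i := by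
  have h := D.realize_diagSplit_simConst X (.var i)
  rw [realize_diagSplit] at h
  refine Eq.trans ?_ h
  change D.op _ (toHom _ (fst _)) (toHom _ (snd _)) = _
  simp

variable {D X}

theorem eq_of_realize_of_const {A : V.Alg} (θ : D.simQuot X ⟶ A) (d : Fin D.k → L.Term Empty)
    (hd : ∀ i, toHom θ (D.simConst X i) = A.const (d i)) {α β : L.Term (X ⊕ Fin D.k)}
    (h : ∀ x : X → A.carrier,
      α.realize (Sum.elim x fun i => A.const (d i)) =
        β.realize (Sum.elim x fun i => A.const (d i))) :
    toHom θ ((D.simCongruence X).cls α) = toHom θ ((D.simCongruence X).cls β) := by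
  have key : ∀ t : L.Term (X ⊕ Fin D.k), toHom θ ((D.simCongruence X).cls t) =
      t.realize (Sum.elim (fun x => toHom θ ((D.simCongruence X).cls (.var (.inl x))))
        fun i => A.const (d i)) := fun t => by
    rw [← TermCongruence.realize_cls_var]
    refine (toHom_realize θ t _).trans ?_
    congr 1
    funext i
    rcases i with i | i
    · rfl
    · exact hd i
  rw [key, key, h]

end SimQuotient

variable {D}

/-- Coextensivity at `0 × 0` makes `simQuot` a product with `c` corresponding to `(e,e')`. The two
hypotheses give equality of the classes of `α` and `β` in the two factors, hence in `simQuot`. -/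
theorem Sim.of_isCoextensive [IsCoextensive V.Alg] {X : Type} {α β : L.Term (X ⊕ Fin D.k)}
    (h : ∀ (A : V.Alg) (x : X → A.carrier),
      α.realize (Sum.elim x fun i => A.const (D.e i)) =
        β.realize (Sum.elim x fun i => A.const (D.e i)))
    (h' : ∀ (A : V.Alg) (x : X → A.carrier),
      α.realize (Sum.elim x fun i => A.const (D.e' i)) =
        β.realize (Sum.elim x fun i => A.const (D.e' i))) :
    D.Sim α β := by
  have := IsCoextensive.isEquivalence V.initial V.initial
  let P := (underProdFunctor V.initial V.initial).objPreimage
    (Under.mk (D.initialProdToSimQuot X))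
  let e : (underProdFunctor V.initial V.initial).obj P ≅ Under.mk (D.initialProdToSimQuot X) :=
    (underProdFunctor V.initial V.initial).objObjPreimageIso _
  let θ : D.simQuot X ≅ P.1.right ⨯ P.2.right := (Under.forget _).mapIso e.symm
  have hθ : ∀ i, toHom θ.hom (D.simConst X i) = D.splitConst _ _ i := by
    intro i
    rw [← initialProdToSimQuot_splitConst, ← map_splitConst D P.1.hom P.2.hom]
    exact congrArg (fun k : V.initial ⨯ V.initial ⟶ P.1.right ⨯ P.2.right => toHom k _)
      (Under.w e.inv)
  have hinj : Function.Injective (toHom θ.hom) := Function.LeftInverse.injective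
    (g := toHom θ.inv) fun a => congrArg (fun k : D.simQuot X ⟶ D.simQuot X => toHom k a)
      θ.hom_inv_id
  refine .of_simCongruence ((TermCongruence.cls_eq_iff _).1 (hinj (pair_ext ?_ ?_)))
  · exact eq_of_realize_of_const (θ.hom ≫ prod.fst) D.e
      (fun i => (congrArg fst (hθ i)).trans (by simp)) (h _)
  · exact eq_of_realize_of_const (θ.hom ≫ prod.snd) D.e'
      (fun i => (congrArg snd (hθ i)).trans (by simp)) (h' _)

theorem idem_of_isCoextensive [IsCoextensive V.Alg] (D : V.DiagonalisingTerm) : D.Idem :=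
  .of_isCoextensive (fun A x => by simp [realize_diagApply]) fun A x => by simp [realize_diagApply]

theorem commutes_of_isCoextensive [IsCoextensive V.Alg] (D : V.DiagonalisingTerm) {p : ℕ}
    (s : L.Functions p) : D.Commutes s :=
  .of_isCoextensive (fun A x => by simp [realize_diagApply]) fun A x => by simp [realize_diagApply]

end DiagonalisingTerm

open Alg

/-! ### Sufficiency: the product functor is fully faithful. -/

namespace DiagonalisingTerm

/-- A constant of an algebra. -/
def point (D : V.DiagonalisingTerm) (A : V.Alg) : A.carrier := A.const (D.e ⟨0, D.one_le_k⟩)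

/-- This is where `k ≥ 1` matters: it provides a constant, so no algebra is empty. -/
theorem prod_fst_surjective (D : V.DiagonalisingTerm) (A B : V.Alg) :
    Function.Surjective (toHom (prod.fst : A ⨯ B ⟶ A)) := fun a =>
  ⟨mkPair a (D.point B), fst_mkPair _ _⟩

theorem prod_snd_surjective (D : V.DiagonalisingTerm) (A B : V.Alg) :
    Function.Surjective (toHom (prod.snd : A ⨯ B ⟶ B)) := fun b =>
  ⟨mkPair (D.point A) b, snd_mkPair _ _⟩

theorem faithful_underProdFunctor (D : V.DiagonalisingTerm) (X Y : V.Alg) :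
    (underProdFunctor X Y).Faithful where
  map_injective {P Q f g} h := by
    have h' : prod.map f.1.right f.2.right = prod.map g.1.right g.2.right :=
      congrArg (fun k => k.right) h
    refine Prod.ext (Under.UnderMorphism.ext (hom_ext fun a => ?_))
      (Under.UnderMorphism.ext (hom_ext fun b => ?_))
    · simpa using congrArg (fun k => fst (toHom k (mkPair a (D.point _)))) h'
    · simpa using congrArg (fun k => snd (toHom k (mkPair (D.point _) b))) h'

section Full

variable {D : V.DiagonalisingTerm} {A B A' B' : V.Alg} {h : A ⨯ B ⟶ A' ⨯ B'}

theorem toHom_mkPair_of_splitConst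
    (hc : ∀ i, toHom h (D.splitConst A B i) = D.splitConst A' B' i) (p q : (A ⨯ B).carrier) :
    toHom h (mkPair (fst p) (snd q)) = mkPair (fst (toHom h p)) (snd (toHom h q)) := by
  rw [← op_splitConst D, toHom_op, funext hc, op_splitConst]

theorem fst_toHom_of_splitConst
    (hc : ∀ i, toHom h (D.splitConst A B i) = D.splitConst A' B' i) {p q : (A ⨯ B).carrier}
    (hpq : fst p = fst q) :
    fst (toHom h p) = fst (toHom h q) := by
  simpa [← hpq] using congrArg fst (toHom_mkPair_of_splitConst hc q p)

theorem snd_toHom_of_splitConst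
    (hc : ∀ i, toHom h (D.splitConst A B i) = D.splitConst A' B' i) {p q : (A ⨯ B).carrier}
    (hpq : snd p = snd q) :
    snd (toHom h p) = snd (toHom h q) := by
  simpa [← hpq] using congrArg snd (toHom_mkPair_of_splitConst hc p q)

end Full

/-- A morphism under `X ⨯ Y` sends `(e,e')` to `(e,e')`, so it preserves `(p, q) ↦ (p₁, q₂)`. Each
component of its value then depends only on the same component of the argument, which yields the two
factors. -/
theorem full_underProdFunctor (D : V.DiagonalisingTerm) (X Y : V.Alg) :
    (underProdFunctor X Y).Full where
  map_surjective {P Q} m := by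
    let h : P.1.right ⨯ P.2.right ⟶ Q.1.right ⨯ Q.2.right := m.right
    have hm : ∀ p, toHom h (toHom (prod.map P.1.hom P.2.hom) p) =
        toHom (prod.map Q.1.hom Q.2.hom) p := fun p =>
      congrArg (fun k : X ⨯ Y ⟶ Q.1.right ⨯ Q.2.right => toHom k p) (Under.w m)
    have hc : ∀ i, toHom h (D.splitConst _ _ i) = D.splitConst _ _ i := fun i => by
      rw [← map_splitConst D P.1.hom P.2.hom, hm, map_splitConst]
    let f : P.1.right ⟶ Q.1.right := descend prod.fst (D.prod_fst_surjective _ P.2.right)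
      (fun a => fst (toHom h (mkPair a (D.point _)))) (h ≫ prod.fst)
      fun p => fst_toHom_of_splitConst hc (fst_mkPair _ _)
    let g : P.2.right ⟶ Q.2.right := descend prod.snd (D.prod_snd_surjective P.1.right _)
      (fun b => snd (toHom h (mkPair (D.point _) b))) (h ≫ prod.snd)
      fun p => snd_toHom_of_splitConst hc (snd_mkPair _ _)
    have hf : P.1.hom ≫ f = Q.1.hom := hom_ext fun x => by
      have h1 := congrArg fst (hm (mkPair x (D.point Y)))
      rw [fst_map, fst_mkPair] at h1
      exact (fst_toHom_of_splitConst hc ((fst_mkPair _ _).trans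
        (by rw [fst_map, fst_mkPair]; rfl))).trans h1
    have hg : P.2.hom ≫ g = Q.2.hom := hom_ext fun y => by
      have h1 := congrArg snd (hm (mkPair (D.point X) y))
      rw [snd_map, snd_mkPair] at h1
      exact (snd_toHom_of_splitConst hc ((snd_mkPair _ _).trans
        (by rw [snd_map, snd_mkPair]; rfl))).trans h1
    refine ⟨(Under.homMk f hf, Under.homMk g hg), Under.UnderMorphism.ext (hom_ext fun p => ?_)⟩
    refine pair_ext ((fst_map f g p).trans ?_) ((snd_map f g p).trans ?_)
    · exact fst_toHom_of_splitConst hc (fst_mkPair _ _)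
    · exact snd_toHom_of_splitConst hc (snd_mkPair _ _)

/-! ### Sufficiency: decomposing an algebra by a rectangular band. -/

section EssSurj

variable {D : V.DiagonalisingTerm} {X Y Z : V.Alg} (h : X ⨯ Y ⟶ Z)

/-- The operation `(z, w) ↦ t(z, w, c)` on an algebra `Z` under `X ⨯ Y`, where `c` is the image of
`(e, e')`. -/
def band (D : V.DiagonalisingTerm) (h : X ⨯ Y ⟶ Z) (z w : Z.carrier) : Z.carrier :=
  D.op (fun i => toHom h (D.splitConst X Y i)) z w

theorem band_toHom (p q : (X ⨯ Y).carrier) :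
    D.band h (toHom h p) (toHom h q) = toHom h (mkPair (fst p) (snd q)) := by
  rw [band, ← toHom_op, op_splitConst]

/-- The relations satisfied by `(e,e')` in `X ⨯ Y` pass to its image in `Z`. By `realize_eq_of_sim`,
conditions 2 and 3 therefore hold as equations at that image. -/
theorem realize_diagSplit_toHom_splitConst (v : L.Term (Fin D.k)) :
    (D.diagSplit v).realize (fun i => toHom h (D.splitConst X Y i)) =
      v.realize fun i => toHom h (D.splitConst X Y i) := by
  rw [← toHom_realize, realize_diagSplit_splitConst, toHom_realize]

theorem band_self (hI : D.Idem) (z : Z.carrier) : D.band h z z = z := by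
  simpa [realize_diagApply, band] using
    realize_eq_of_sim hI _ (realize_diagSplit_toHom_splitConst h) fun _ => z

theorem band_funMap (hC : ∀ (p : ℕ) (s : L.Functions p), D.Commutes s)
    {p : ℕ} (s : L.Functions p) (z w : Fin p → Z.carrier) :
    D.band h (funMap s z) (funMap s w) = funMap s fun i => D.band h (z i) (w i) := by
  simpa [realize_diagApply, band] using
    (realize_eq_of_sim (hC p s) _ (realize_diagSplit_toHom_splitConst h) (Sum.elim z w)).symm

theorem band_realize (hC : ∀ (p : ℕ) (s : L.Functions p), D.Commutes s)
    {α : Type*} (t : L.Term α) (z w : α → Z.carrier) :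
    D.band h (t.realize z) (t.realize w) = t.realize fun i => D.band h (z i) (w i) := by
  induction t with
  | var => rfl
  | func s ts ih => simp only [Term.realize_func, band_funMap h hC, ih]

theorem band_op (hC : ∀ (p : ℕ) (s : L.Functions p), D.Commutes s)
    (c c' : Fin D.k → Z.carrier) (z w z' w' : Z.carrier) :
    D.band h (D.op c z w) (D.op c' z' w') =
      D.op (fun i => D.band h (c i) (c' i)) (D.band h z z') (D.band h w w') := by
  rw [op, op, band_realize h hC, op]
  congr 1
  funext i
  rcases i with i | i
  · fin_cases i <;> rfl
  · rfl

/-- The band operation commutes with every term, in particular with `t`. Write `z·w = t(z,w,c)` and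
`y = t(y,y,e)`; since `cᵢ·eᵢ = eᵢ`, the product is `t(z·y, w·y, e) = z·y`. The right-hand version
uses `e'` in the same way. -/
theorem band_band_left (hC : ∀ (p : ℕ) (s : L.Functions p), D.Commutes s)
    (z w y : Z.carrier) :
    D.band h (D.band h z w) y = D.band h z y := by
  have hc : ∀ i, D.band h (toHom h (D.splitConst X Y i)) (Z.const (D.e i)) = Z.const (D.e i) := by
    intro i
    rw [← toHom_const h, band_toHom]
    congr 1
    exact pair_ext (by simp) (by simp)
  have h1 := band_op h hC (fun i => toHom h (D.splitConst X Y i)) (fun i => Z.const (D.e i)) z w y y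
  simp only [hc, op_const_e] at h1
  exact h1

theorem band_band_right (hC : ∀ (p : ℕ) (s : L.Functions p), D.Commutes s)
    (z w y : Z.carrier) :
    D.band h z (D.band h w y) = D.band h z y := by
  have hc : ∀ i, D.band h (Z.const (D.e' i)) (toHom h (D.splitConst X Y i)) = Z.const (D.e' i) := by
    intro i
    rw [← toHom_const h, band_toHom]
    congr 1
    exact pair_ext (by simp) (by simp)
  have h1 := band_op h hC (fun i => Z.const (D.e' i))
    (fun i => toHom h (D.splitConst X Y i)) z z w y
  simp only [hc, op_const_e'] at h1
  exact h1

/-- The kernel of the first projection of the decomposition of `Z`. -/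
def fstKer (hI : D.Idem) (hC : ∀ (p : ℕ) (s : L.Functions p), D.Commutes s) :
    Setoid Z.carrier where
  r z w := D.band h z w = w
  iseqv :=
    { refl := band_self h hI
      symm := fun {z w} hz => by rw [← hz, band_band_left h hC, band_self h hI]
      trans := fun {z w y} h1 h2 => by rw [← band_band_left h hC z w, h1, h2] }

/-- The kernel of the second projection of the decomposition of `Z`. -/
def sndKer (hI : D.Idem) (hC : ∀ (p : ℕ) (s : L.Functions p), D.Commutes s) :
    Setoid Z.carrier where
  r z w := D.band h z w = z
  iseqv :=
    { refl := band_self h hI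
      symm := fun {z w} hz => by rw [← hz, band_band_right h hC, band_self h hI]
      trans := fun {z w y} h1 h2 => by rw [← band_band_right h hC z w, h2, h1] }

/-- In a product with `z·w = (z₁,w₂)`, equality of first components means `z·w = w` and equality of
second components means `z·w = z`. These two relations are congruences on `Z`, and the quotients by
them are the factors. The element with the first class of `z` and the second class of `w` is `z·w`.
-/
theorem essSurj_underProdFunctor (hI : D.Idem)
    (hC : ∀ (p : ℕ) (s : L.Functions p), D.Commutes s) (X Y : V.Alg) :
    (underProdFunctor X Y).EssSurj where
  mem_essImage W := by
    let Z : V.Alg := W.right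
    let h : X ⨯ Y ⟶ Z := W.hom
    have h₁ : ∀ {n : ℕ} (s : L.Functions n) (x y : Fin n → Z.carrier),
        (∀ i, fstKer h hI hC (x i) (y i)) → fstKer h hI hC (funMap s x) (funMap s y) :=
      fun s x y hxy => (band_funMap h hC s x y).trans (congrArg _ (funext hxy))
    have h₂ : ∀ {n : ℕ} (s : L.Functions n) (x y : Fin n → Z.carrier),
        (∀ i, sndKer h hI hC (x i) (y i)) → sndKer h hI hC (funMap s x) (funMap s y) :=
      fun s x y hxy => (band_funMap h hC s x y).trans (congrArg _ (funext hxy))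
    let q₁ := Z.toQuotient _ h₁
    let q₂ := Z.toQuotient _ h₂
    have hq₁ : ∀ {z w}, D.band h z w = w → toHom q₁ z = toHom q₁ w :=
      fun hzw => (Z.toQuotient_eq_iff _ h₁ _ _).2 hzw
    have hq₂ : ∀ {z w}, D.band h z w = z → toHom q₂ z = toHom q₂ w :=
      fun hzw => (Z.toQuotient_eq_iff _ h₂ _ _).2 hzw
    have hi : ∀ p, toHom q₁ (toHom h (mkPair (fst p) (D.point Y))) = toHom q₁ (toHom h p) :=
      fun p => hq₁ (by simp [band_toHom])
    have hj : ∀ p, toHom q₂ (toHom h (mkPair (D.point X) (snd p))) = toHom q₂ (toHom h p) :=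
      fun p => hq₂ (by simp [band_toHom])
    let i : X ⟶ _ := descend prod.fst (D.prod_fst_surjective X Y)
      (fun x => toHom q₁ (toHom h (mkPair x (D.point Y)))) (h ≫ q₁) hi
    let j : Y ⟶ _ := descend prod.snd (D.prod_snd_surjective X Y)
      (fun y => toHom q₂ (toHom h (mkPair (D.point X) y))) (h ≫ q₂) hj
    have hbij : Function.Bijective (toHom (prod.lift q₁ q₂)) := by
      refine ⟨fun z w hzw => ?_, fun p => ?_⟩
      · have e₁ := congrArg fst hzw
        have e₂ := congrArg snd hzw
        rw [fst_lift, fst_lift] at e₁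
        rw [snd_lift, snd_lift] at e₂
        -- If `z` and `w` agree in both quotients, then `z = z·w = w`.
        exact Eq.trans ((Z.toQuotient_eq_iff _ h₂ _ _).1 e₂ : D.band h z w = z).symm
          ((Z.toQuotient_eq_iff _ h₁ _ _).1 e₁)
      · obtain ⟨z, hz⟩ := Z.toQuotient_surjective _ h₁ (fst p)
        obtain ⟨w, hw⟩ := Z.toQuotient_surjective _ h₂ (snd p)
        refine ⟨D.band h z w, pair_ext ?_ ?_⟩
        · rw [fst_lift, ← hz]
          exact (hq₁ (band_band_right h hC z z w)).symm
        · rw [snd_lift, ← hw]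
          exact hq₂ (band_band_left h hC z w w)
    have : IsIso (prod.lift q₁ q₂) := isIso_of_bijective _ hbij
    let θ := asIso (prod.lift q₁ q₂)
    refine ⟨(Under.mk i, Under.mk j), ⟨(Under.isoMk (f := W)
      (g := (underProdFunctor X Y).obj (Under.mk i, Under.mk j))
      θ (hom_ext fun p => ?_)).symm⟩⟩
    refine pair_ext ?_ ?_
    · exact (fst_lift q₁ q₂ _).trans ((hi p).symm.trans (fst_map i j p).symm)
    · exact (snd_lift q₁ q₂ _).trans ((hj p).symm.trans (snd_map i j p).symm)

theorem isCoextensive (hI : D.Idem) (hC : ∀ (p : ℕ) (s : L.Functions p), D.Commutes s) :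
    IsCoextensive V.Alg where
  isEquivalence X Y :=
    { faithful := D.faithful_underProdFunctor X Y
      full := D.full_underProdFunctor X Y
      essSurj := essSurj_underProdFunctor hI hC X Y }

end EssSurj

end DiagonalisingTerm

end Variety

end

theorem theorem2p7 (L : FirstOrder.Language.{u, v}) [L.IsAlgebraic] (V : Variety L) :
    (IsCoextensive V.Alg ↔
      ∃ D : V.DiagonalisingTerm, D.Idem ∧ ∀ (p : ℕ) (s : L.Functions p), D.Commutes s) ∧
    (∀ D : V.DiagonalisingTerm,
      IsCoextensive V.Alg ↔ D.Idem ∧ ∀ (p : ℕ) (s : L.Functions p), D.Commutes s) := by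
  have key : ∀ D : V.DiagonalisingTerm,
      IsCoextensive V.Alg ↔ D.Idem ∧ ∀ (p : ℕ) (s : L.Functions p), D.Commutes s := fun D =>
    ⟨fun _ => ⟨D.idem_of_isCoextensive, fun _ s => D.commutes_of_isCoextensive s⟩,
      fun h => Variety.DiagonalisingTerm.isCoextensive h.1 h.2⟩
  refine ⟨⟨fun hV => ?_, fun ⟨D, hD⟩ => (key D).2 hD⟩, key⟩
  obtain ⟨D⟩ := Variety.exists_diagonalisingTerm (V := V)
  exact ⟨D, (key D).1 hV⟩
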